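/- Let $X$ be a compact connected (Hausdorff) complex manifold of dimension $k$. A holomorphic correspondence $F$ on $X$ is a formal sum $\Gamma=\sum_{j=1}^N m_j\Gamma_j$ ($N\ge 1$) with positive integers $m_j$ and distinct irreducible complex subvarieties $\Gamma_j\subset X\times X$ of dimension $k$, such that both coordinate projections $\pi_1,\pi_2$ map each $\Gamma_j$ onto $X$ and every point of $X$ has, counted with multiplicity, only finitely many images and preimages under $\Gamma$. Put $|\Gamma|=\bigcup_j\Gamma_j$, $F(A)=\pi_2(\pi_1^{-1}(A)\cap|\Gamma|)$, $F^{\dagger}(A)=\pi_1(\pi_2^{-1}(A)\cap|\Gamma|)$, $F^0(A)=A$ and $F^{n}(A)=F(F^{n-1}(A))$ for $A\subseteq X$. Let $d$ be the topological degree of $F$, that is, the number of points of $F^{\dagger}(z)$, counted with multiplicity, for generic $z\in X$. Let $\mu$ be a Borel probability measure on $X$ that is $F^*$-invariant, i.e. $\int_X\sum'_{w\in F^{\dagger}(z)}\varphi(w)\,d\mu(z)=d\int_X\varphi\,d\mu$ for every continuous $\varphi:X\to\mathbb{R}$, where $\sum'$ means that points are repeated according to multiplicity. A Borel set $B$ is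 called almost invariant if there is a Borel set $B'\subseteq B$ with $\mu(B')=\mu(B)$ and $F^{\dagger}(B')\subseteq B$; $F$ is called ergodic with respect to $\mu$ if every almost invariant Borel set $B$ has $\mu(B)=0$ or $\mu(B)=1$. If $$\lim_{n\to\infty}\frac1n\sum_{j=0}^{n-1}\mu\bigl(F^j(A)\cap C\bigr)=\mu(A)\,\mu(C)$$ for all Borel sets $A,C\subseteq X$, then $F$ is ergodic with respect to $\mu$. -/

import Mathlib

open MeasureTheory Filter Topology
open scoped Manifold ContDiff

section AnalyticSets

variable {E : Type*} [NormedAddCommGroup E] [NormedSpace ℂ E]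
  {H : Type*} [TopologicalSpace H] (I : ModelWithCorners ℂ E H)
  {M : Type*} [TopologicalSpace M] [ChartedSpace H M]

/-- `S` is a complex subvariety (closed analytic subset) of the complex manifold `M`: near every
point of `M` it is the common zero set of finitely many holomorphic functions. -/
def IsSubvariety (S : Set M) : Prop :=
  ∀ p : M, ∃ U : Set M, IsOpen U ∧ p ∈ U ∧ ∃ (n : ℕ) (f : Fin n → M → ℂ),
    (∀ i, ContMDiffOn I 𝓘(ℂ, ℂ) ω (f i) U) ∧ S ∩ U = {x ∈ U | ∀ i, f i x = 0}

/-- An irreducible subvariety: nonempty, and not the union of two proper subvarieties. -/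
def IsIrreducibleSubvariety (S : Set M) : Prop :=
  IsSubvariety I S ∧ S.Nonempty ∧
    ∀ A B : Set M, IsSubvariety I A → IsSubvariety I B → S = A ∪ B → S = A ∨ S = B

/-- Near `p ∈ S`, the set `S` is a complex submanifold of `M` of complex dimension `r`: in some
holomorphic chart around `p` it is an `r`-dimensional linear subspace. -/
def IsRegularPointOfDim (S : Set M) (r : ℕ) (p : M) : Prop :=
  p ∈ S ∧ ∃ e ∈ IsManifold.maximalAtlas I ω M, p ∈ e.source ∧
    ∃ V : Submodule ℂ E, Module.finrank ℂ V = r ∧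
      ∀ x ∈ e.source, x ∈ S ↔ e.extend I x ∈ V

/-- `S` has (pure) complex dimension `r`: the points near which `S` is an `r`-dimensional complex
submanifold are dense in `S`. -/
def HasPureDim (S : Set M) (r : ℕ) : Prop :=
  S ⊆ closure {p | IsRegularPointOfDim I S r p}

end AnalyticSets

/-- The multiplicity at `p` of the restriction to `S` of the map `f`: the maximal number of points
of `S` in one fibre of `f` that lie arbitrarily close to `p`. For a finite holomorphic map
from an analytic set of pure dimension `k` to a `k`-dimensional manifold this is the number of
sheets at `p` of the associated branched covering (its local degree). -/
noncomputable def localMultiplicity {M Y : Type*} [TopologicalSpace M]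
    (f : M → Y) (S : Set M) (p : M) : ℕ∞ :=
  ⨅ U ∈ 𝓝 p, ⨆ y : Y, (S ∩ U ∩ f ⁻¹' {y}).encard

/-- A holomorphic correspondence `∑ j, m j • Γ j` on a complex manifold `X` of dimension `k`. -/
structure HolomorphicCorrespondence (k : ℕ) (X : Type*) [TopologicalSpace X]
    [ChartedSpace (EuclideanSpace ℂ (Fin k)) X] where
  /-- the number of components -/
  N : ℕ
  N_pos : 0 < N
  /-- the multiplicities of the components -/
  m : Fin N → ℕ
  m_pos : ∀ j, 0 < m j
  /-- the components, subvarieties of `X × X` -/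
  comp : Fin N → Set (X × X)
  comp_injective : Function.Injective comp
  irreducible : ∀ j, IsIrreducibleSubvariety
    (𝓘(ℂ, EuclideanSpace ℂ (Fin k)).prod 𝓘(ℂ, EuclideanSpace ℂ (Fin k))) (comp j)
  dim : ∀ j, HasPureDim
    (𝓘(ℂ, EuclideanSpace ℂ (Fin k)).prod 𝓘(ℂ, EuclideanSpace ℂ (Fin k))) (comp j) k
  surj_fst : ∀ j, Prod.fst '' comp j = Set.univ
  surj_snd : ∀ j, Prod.snd '' comp j = Set.univ
  /-- every point has finitely many images, counted with multiplicity -/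
  finite_image : ∀ z : X, (⋃ j, Prod.snd '' (Prod.fst ⁻¹' {z} ∩ comp j)).Finite ∧
    ∀ j w, localMultiplicity Prod.fst (comp j) (z, w) ≠ ⊤
  /-- every point has finitely many preimages, counted with multiplicity -/
  finite_preimage : ∀ z : X, (⋃ j, Prod.fst '' (Prod.snd ⁻¹' {z} ∩ comp j)).Finite ∧
    ∀ j w, localMultiplicity Prod.snd (comp j) (w, z) ≠ ⊤

namespace HolomorphicCorrespondence

section

variable {k : ℕ} {X : Type*} [TopologicalSpace X] [ChartedSpace (EuclideanSpace ℂ (Fin k)) X]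
  (F : HolomorphicCorrespondence k X)

/-- The underlying set `|Γ|`. -/
def support : Set (X × X) := ⋃ j, F.comp j

/-- The image `F(A)`. Its iterates `F^n(A)` are `F.image^[n] A`. -/
def image (A : Set X) : Set X := Prod.snd '' (Prod.fst ⁻¹' A ∩ F.support)

/-- The preimage `F†(A)`. -/
def preimage (A : Set X) : Set X := Prod.fst '' (Prod.snd ⁻¹' A ∩ F.support)

/-- The multiplicity with which `w` occurs in `F†(z)`. -/
noncomputable def preimageMult (z w : X) : ℕ :=
  ∑ j, F.m j * (localMultiplicity Prod.snd (F.comp j) (w, z)).toNat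

/-- The sum of `φ w` over `w ∈ F†(z)`, points being repeated according to multiplicity. -/
noncomputable def preimageSum (φ : X → ℝ) (z : X) : ℝ :=
  ∑ᶠ w ∈ F.preimage {z}, (F.preimageMult z w : ℝ) * φ w

/-- The cardinality of `F†(z)`, counted with multiplicity. -/
noncomputable def preimageCard (z : X) : ℕ := ∑ᶠ w ∈ F.preimage {z}, F.preimageMult z w

/-- `d` is the topological degree of `F`: the number of preimages, counted with multiplicity, of
a generic point, i.e. of every point outside some proper subvariety of `X`. -/
def IsTopologicalDegree (d : ℕ) : Prop :=
  ∃ S : Set X, IsSubvariety 𝓘(ℂ, EuclideanSpace ℂ (Fin k)) S ∧ S ≠ Set.univ ∧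
    ∀ z, z ∉ S → F.preimageCard z = d

variable [MeasurableSpace X]

/-- `F^* μ = d μ`, where `⟨F^* μ, φ⟩ = ∫ ∑_{w ∈ F†(z)} φ(w) dμ(z)` for continuous `φ`. -/
def IsPullbackInvariant (d : ℕ) (μ : Measure X) : Prop :=
  ∀ φ : C(X, ℝ), ∫ z, F.preimageSum φ z ∂μ = d * ∫ z, φ z ∂μ

/-- The Borel set `B` is almost invariant with respect to `F` and `μ`. -/
def IsAlmostInvariant (μ : Measure X) (B : Set X) : Prop :=
  MeasurableSet B ∧ ∃ B' : Set X, MeasurableSet B' ∧ B' ⊆ B ∧ μ B = μ B' ∧ F.preimage B' ⊆ B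

/-- `F` is ergodic with respect to the probability measure `μ`. -/
def IsErgodic (μ : Measure X) : Prop :=
  ∀ B : Set X, F.IsAlmostInvariant μ B → μ B = 0 ∨ μ B = 1

end

end HolomorphicCorrespondence

section Subvarieties

variable {E : Type*} [NormedAddCommGroup E] [NormedSpace ℂ E]
  {H : Type*} [TopologicalSpace H] {I : ModelWithCorners ℂ E H}
  {M : Type*} [TopologicalSpace M] [ChartedSpace H M]

/-! Taking `C = X` in the hypothesis, the averages of `μ (F^j(D))` tend to `μ D`, and those of the
shifted sequence to `μ (F(D))`; hence `F` preserves the measure of `D`. If `B` is almost invariant,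
images of sets outside `B` miss `B'`, so forward images of a set null on `B` stay null on `B`
(`measure_image_inter_eq_zero`). Starting from almost all of `Bᶜ`, every term of the Cesàro mean
against `B` vanishes, so `μ(Bᶜ) μ(B) = 0`. Everything is done with σ-compact sets: `|Γ|` is closed
and `X` compact, so their images are again σ-compact, hence Borel. -/

theorem IsSubvariety.isClosed {S : Set M} (hS : IsSubvariety I S) : IsClosed S := by
  rw [← isOpen_compl_iff, isOpen_iff_mem_nhds]
  intro p hp
  obtain ⟨U, hU, hpU, n, f, hf, hSU⟩ := hS p
  have hne : ∃ i, f i p ≠ 0 := by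
    by_contra! hzero
    exact hp (hSU.symm.subset ⟨hpU, hzero⟩).1
  obtain ⟨i, hi⟩ := hne
  have hcont : ContinuousAt (f i) p := (hf i).continuousOn.continuousAt (hU.mem_nhds hpU)
  filter_upwards [hcont.eventually_ne hi, hU.mem_nhds hpU] with x hx hxU hxS
  exact hx ((hSU.subset ⟨hxS, hxU⟩).2 i)

end Subvarieties

/-- If two sequences with Cesàro limits `a`, `b` differ by a shift, then `a = b`. -/
theorem cesaro_limit_shift_eq {u : ℕ → ℝ} {a b : ℝ} {K : ℝ} (hu : ∀ j, |u j| ≤ K)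
    (ha : Tendsto (fun n : ℕ => (1 / (n : ℝ)) * ∑ j ∈ Finset.range n, u j) atTop (𝓝 a))
    (hb : Tendsto (fun n : ℕ => (1 / (n : ℝ)) * ∑ j ∈ Finset.range n, u (j + 1)) atTop (𝓝 b)) :
    b = a := by
  have hdiff : Tendsto (fun n : ℕ => (1 / (n : ℝ)) * (u n - u 0)) atTop (𝓝 0) := by
    refine tendsto_one_div_atTop_nhds_zero_nat.zero_mul_isBoundedUnder_le ?_
    refine ⟨K + K, eventually_map.2 (Eventually.of_forall fun n => ?_)⟩
    exact (abs_sub _ _).trans (add_le_add (hu n) (hu 0))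
  have hsub := hb.sub ha
  refine sub_eq_zero.1 (tendsto_nhds_unique hsub (hdiff.congr fun n => ?_))
  rw [← mul_sub, ← Finset.sum_sub_distrib, Finset.sum_range_sub]

theorem IsSigmaCompact.measurableSet {X : Type*} [TopologicalSpace X] [T2Space X]
    [MeasurableSpace X] [OpensMeasurableSpace X] {S : Set X} (hS : IsSigmaCompact S) :
    MeasurableSet S := by
  obtain ⟨K, hK, rfl⟩ := hS
  exact MeasurableSet.iUnion fun n => (hK n).measurableSet

/-- Take the union of compact subsets that exhaust the measure up to `1/(n+1)`. This replaces a
Borel set by one whose iterated images are visibly Borel. -/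
theorem MeasurableSet.exists_isSigmaCompact_subset_measure_eq {X : Type*} [TopologicalSpace X]
    [MeasurableSpace X] (μ : Measure X) [IsFiniteMeasure μ] [μ.InnerRegularCompactLTTop]
    {A : Set X} (hA : MeasurableSet A) :
    ∃ S ⊆ A, IsSigmaCompact S ∧ μ S = μ A := by
  have hex (n : ℕ) := hA.exists_isCompact_lt_add (measure_ne_top μ A)
    (ε := ((n : ENNReal) + 1)⁻¹) (by simp)
  choose K hKA hK hlt using hex
  refine ⟨⋃ n, K n, Set.iUnion_subset hKA, isSigmaCompact_iUnion_of_isCompact K hK,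
    le_antisymm (measure_mono (Set.iUnion_subset hKA)) ?_⟩
  have hlim : Tendsto (fun n : ℕ => μ (⋃ n, K n) + ((n : ENNReal) + 1)⁻¹) atTop
      (𝓝 (μ (⋃ n, K n) + 0)) := by
    refine tendsto_const_nhds.add ?_
    exact_mod_cast (tendsto_add_atTop_iff_nat 1).2 ENNReal.tendsto_inv_nat_nhds_zero
  rw [add_zero] at hlim
  refine ge_of_tendsto' hlim fun n => (hlt n).le.trans ?_
  gcongr
  exact Set.subset_iUnion K n

namespace HolomorphicCorrespondence

variable {k : ℕ} {X : Type*} [TopologicalSpace X] [ChartedSpace (EuclideanSpace ℂ (Fin k)) X]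
  (F : HolomorphicCorrespondence k X)

theorem isClosed_support : IsClosed F.support :=
  isClosed_iUnion_of_finite fun j => (F.irreducible j).1.isClosed

theorem image_mono {A B : Set X} (hAB : A ⊆ B) : F.image A ⊆ F.image B :=
  Set.image_mono (Set.inter_subset_inter_left _ (Set.preimage_mono hAB))

theorem image_iUnion {ι : Type*} (A : ι → Set X) : F.image (⋃ i, A i) = ⋃ i, F.image (A i) := by
  simp only [image, Set.preimage_iUnion, Set.iUnion_inter, Set.image_iUnion]

theorem disjoint_image_of_preimage_subset {A B : Set X} (hB : F.preimage B ⊆ Aᶜ) :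
    Disjoint (F.image A) B := by
  rw [Set.disjoint_left]
  rintro _ ⟨p, ⟨hpA, hp⟩, rfl⟩ hpB
  exact hB ⟨p, ⟨hpB, hp⟩, rfl⟩ hpA

theorem isSigmaCompact_image [T2Space X] [CompactSpace X] {A : Set X} (hA : IsSigmaCompact A) :
    IsSigmaCompact (F.image A) := by
  obtain ⟨K, hK, rfl⟩ := hA
  rw [image_iUnion]
  refine isSigmaCompact_iUnion_of_isCompact _ fun n => ?_
  exact (((hK n).isClosed.preimage continuous_fst).inter F.isClosed_support).isCompact.image
    continuous_snd

section Mixing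

variable [T2Space X] [CompactSpace X] [MeasurableSpace X] [BorelSpace X]
  {F} {μ : Measure X} [IsProbabilityMeasure μ]
  (h : ∀ A C : Set X, MeasurableSet A → MeasurableSet C →
    Tendsto (fun n : ℕ => (1 / (n : ℝ)) * ∑ j ∈ Finset.range n, μ.real (F.image^[j] A ∩ C))
      atTop (𝓝 (μ.real A * μ.real C)))

include h

/-- The orbit of `F(D)` is the orbit of `D` shifted by one, so both have the same Cesàro limit; with
`C = X` these limits are the two measures. -/
theorem measure_image_eq_of_tendsto {D : Set X} (hD : IsSigmaCompact D) :
    μ (F.image D) = μ D := by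
  have h₁ := h D Set.univ hD.measurableSet MeasurableSet.univ
  have h₂ := h (F.image D) Set.univ (F.isSigmaCompact_image hD).measurableSet MeasurableSet.univ
  simp only [Set.inter_univ, probReal_univ, mul_one, ← Function.iterate_succ_apply] at h₁ h₂
  have hreal := cesaro_limit_shift_eq (u := fun j => μ.real (F.image^[j] D)) (K := 1)
    (fun j => by rw [abs_of_nonneg measureReal_nonneg]; exact measureReal_le_one) h₁ h₂
  exact (measureReal_eq_measureReal_iff).1 hreal

variable [μ.InnerRegularCompactLTTop]

/-- Inductive step. Only nullity, not disjointness, can be propagated: `F(D)` may meet `B` inside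
the null set `B \ B'`. -/
theorem measure_image_inter_eq_zero {B B' D : Set X} (hB : MeasurableSet B)
    (hB'B : B' ⊆ B) (hB' : MeasurableSet B') (hμB : μ B = μ B') (hpre : F.preimage B' ⊆ B)
    (hD : IsSigmaCompact D) (hDB : μ (D ∩ B) = 0) : μ (F.image D ∩ B) = 0 := by
  obtain ⟨S, hSD, hS, hμS⟩ :=
    (hD.measurableSet.diff hB).exists_isSigmaCompact_subset_measure_eq μ
  -- `S` fills `D` up to a null set. An image of a null set need not be null a priori; measure
  -- preservation is what makes `F(D) \ F(S)` null.
  have hFS : μ (F.image S) = μ (F.image D) := by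
    rw [measure_image_eq_of_tendsto h hS, measure_image_eq_of_tendsto h hD, hμS,
      ← measure_inter_add_sdiff D hB, hDB, zero_add]
  have hnull : μ (F.image D \ F.image S) = 0 := by
    rw [measure_sdiff (F.image_mono (hSD.trans Set.sdiff_subset))
      (F.isSigmaCompact_image hS).measurableSet.nullMeasurableSet (measure_ne_top _ _), hFS,
      tsub_self]
  have hnull' : μ (B \ B') = 0 := by
    rw [measure_sdiff hB'B hB'.nullMeasurableSet (measure_ne_top _ _), hμB, tsub_self]
  have hdisj : Disjoint (F.image S) B' :=
    F.disjoint_image_of_preimage_subset (hpre.trans fun x hxB hxS => (hSD hxS).2 hxB)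
  refine measure_mono_null ?_ (measure_union_null hnull hnull')
  rintro x ⟨hxD, hxB⟩
  by_cases hxS : x ∈ F.image S
  · exact Or.inr ⟨hxB, Set.disjoint_left.1 hdisj hxS⟩
  · exact Or.inl ⟨hxD, hxS⟩

theorem isErgodic_of_tendsto : F.IsErgodic μ := by
  rintro B ⟨hB, B', hB', hB'B, hμB, hpre⟩
  obtain ⟨S, hSB, hS, hμS⟩ := hB.compl.exists_isSigmaCompact_subset_measure_eq μ
  have hiter (j : ℕ) : IsSigmaCompact (F.image^[j] S) ∧ μ (F.image^[j] S ∩ B) = 0 := by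
    induction j with
    | zero =>
      refine ⟨hS, ?_⟩
      rw [Function.iterate_zero_apply, (Set.disjoint_left.2 hSB).inter_eq, measure_empty]
    | succ j ih =>
      rw [Function.iterate_succ_apply']
      exact ⟨F.isSigmaCompact_image ih.1,
        measure_image_inter_eq_zero h hB hB'B hB' hμB hpre ih.1 ih.2⟩
  have hlim := h S B hS.measurableSet hB
  have hzero (j : ℕ) : μ.real (F.image^[j] S ∩ B) = 0 := by
    rw [Measure.real, (hiter j).2, ENNReal.toReal_zero]
  simp only [hzero, Finset.sum_const_zero, mul_zero] at hlim
  rcases mul_eq_zero.1 (tendsto_nhds_unique hlim tendsto_const_nhds) with hz | hz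
  · right
    rw [measureReal_eq_zero_iff, hμS] at hz
    exact (prob_compl_eq_zero_iff hB).1 hz
  · exact Or.inl ((measureReal_eq_zero_iff).1 hz)

end Mixing

end HolomorphicCorrespondence

theorem proposition4 {k : ℕ} {X : Type*} [TopologicalSpace X] [T2Space X] [CompactSpace X]
    [ConnectedSpace X] [ChartedSpace (EuclideanSpace ℂ (Fin k)) X]
    [IsManifold 𝓘(ℂ, EuclideanSpace ℂ (Fin k)) ω X] [MeasurableSpace X] [BorelSpace X]
    (F : HolomorphicCorrespondence k X) (d : ℕ) (hd : F.IsTopologicalDegree d)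
    (μ : Measure X) [IsProbabilityMeasure μ] (hμ : F.IsPullbackInvariant d μ)
    (h : ∀ A C : Set X, MeasurableSet A → MeasurableSet C →
      Tendsto (fun n : ℕ => (1 / (n : ℝ)) * ∑ j ∈ Finset.range n, μ.real (F.image^[j] A ∩ C))
        atTop (𝓝 (μ.real A * μ.real C))) :
    F.IsErgodic μ := by
  -- A compact manifold is second countable, hence metrizable, which supplies the inner regularity
  -- of `μ` by compact sets.
  have : SecondCountableTopology X :=
    ChartedSpace.secondCountable_of_sigmaCompact (EuclideanSpace ℂ (Fin k)) X
  let _ : MetricSpace X := TopologicalSpace.metrizableSpaceMetric X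
  exact HolomorphicCorrespondence.isErgodic_of_tendsto h
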